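/- Let $\mathcal H$ be a complex Hilbert space, $d$ a nonnegative integer, $n=(n_1,\dots,n_d)\in\mathbb N_0^d$, $K=\prod_{i=1}^d\{0,\dots,n_i\}\subseteq\mathbb N_0^d$ and $K-K=\{a-b: a,b\in K\}\subseteq\mathbb Z^d$. For $z\in\mathbb T^d=\{z\in\mathbb C^d: |z_i|=1 \text{ for all } i\}$ and $k\in\mathbb Z^d$ write $z^k=z_1^{k_1}\cdots z_d^{k_d}$. Let $Q_k$, $k\in K-K$, be bounded operators on $\mathcal H$ such that $$Q(z):=\sum_{k\in K-K}Q_kz^k\ge 0\qquad\text{for all } z\in\mathbb T^d .$$ Identify the Hardy space $H^2_{\mathcal H}(\mathbb D^d)$ with $\ell^2(\mathbb N_0^d;\mathcal H)$ through Taylor coefficients. For a trigonometric polynomial $A(z)=\sum_k A_kz^k$ with bounded operator coefficients on $\mathcal H$, let $T_A=(A_{i-j})_{i,j\in\mathbb N_0^d}$ be the Toeplitz operator on $H^2_{\mathcal H}(\mathbb D^d)$ with symbol $A$. For $\Lambda\subseteq\mathbb N_0^d$ let $\Pi_\Lambda$ be the projection $\Pi_\Lambda\big(\sum_k h_kz^k\big)=\sum_{k\in\Lambda}h_kz^k$.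 For a positive semidefinite operator $M$ on $H^2_{\mathcal H}(\mathbb D^d)$ let $S(M;\Lambda)$ be the Schur complement of $M$ supported on the rows and columns in $\Lambda$, padded with zeros, that is, the largest self-adjoint operator $S$ with $\Pi_\Lambda S\,\Pi_\Lambda=S$ and $S\le M$. Put $$Y:=S(T_Q;K)-S(T_Q;K\setminus\{n\}),\qquad Z_K(z):=\operatorname{col}(z^{n-k})_{k\in K},$$ so that $Z_K(z)^*\,Y\,Z_K(z)=\sum_{k,l\in K}\overline{z^{\,n-k}}\,Y_{k,l}\,z^{\,n-l}$. The following are equivalent: (i) there is an operator polynomial $P(z)=\sum_{k\in K}P_kz^k$, with bounded operators $P_k$ on $\mathcal H$, such that $Q(z)=P(z)^*P(z)$ for all $z\in\mathbb T^d$, $$\operatorname{ran}\big(\Pi_{\mathbb N_0^d\setminus K}\,T_P\,\Pi_{\{n\}}\big)\subseteq\overline{\operatorname{ran}}\,\big(\Pi_{\mathbb N_0^d\setminus K}\,T_P\,\Pi_{\mathbb N_0^d\setminus K}\big),$$ and $\operatorname{ran}P_k\subseteq\overline{\operatorname{ran}}\,P_0$ for all $k\in K$; (ii) $Z_K(z)^*\,Y\,Z_K(z)=Q(z)$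 for all $z\in\mathbb T^d$. -/

import Mathlib

open scoped Pointwise ENNReal

noncomputable section

namespace OuterFactorization

/-- The Hilbert space `ℓ²(ι; H)` of square summable `H`-valued families indexed by `ι`. -/
abbrev EllTwo (ι : Type*) (H : Type*) [NormedAddCommGroup H] : Type _ :=
  lp (fun _ : ι => H) 2

section Shorted

variable {E : Type*} [NormedAddCommGroup E] [InnerProductSpace ℂ E] [CompleteSpace E]

/-- For a positive semidefinite operator `M` on a Hilbert space and a subspace `V`, the operator
`M^{1/2} G M^{1/2}`, where `G` is the orthogonal projection onto the orthogonal complement of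
`M^{1/2} V`. It is the largest self-adjoint operator that vanishes on `V` and is `≤ M`; this is the
Schur complement of `M` supported on the orthogonal complement of `V`, padded with zeros. -/
def shortedOperator (M : E →L[ℂ] E) (V : Submodule ℂ E) : E →L[ℂ] E :=
  CFC.sqrt M ∘L (V.map (CFC.sqrt M).toLinearMap)ᗮ.starProjection ∘L CFC.sqrt M

theorem shortedOperator_isGreatest (M : E →L[ℂ] E) (hM : 0 ≤ M) (V : Submodule ℂ E) :
    IsGreatest {S : E →L[ℂ] E | IsSelfAdjoint S ∧ (∀ x ∈ V, S x = 0) ∧ S ≤ M}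
      (shortedOperator M V) := by
  set R : E →L[ℂ] E := CFC.sqrt M with hR
  have hRR : R ∘L R = M := CFC.sqrt_mul_sqrt_self M hM
  have hRpos : R.IsPositive := (ContinuousLinearMap.nonneg_iff_isPositive _).1 (CFC.sqrt_nonneg M)
  have hRadj : ContinuousLinearMap.adjoint R = R := hRpos.isSelfAdjoint
  set U : Submodule ℂ E := V.map R.toLinearMap with hU
  set G : E →L[ℂ] E := Uᗮ.starProjection with hG
  have hS : shortedOperator M V = R ∘L G ∘L R := rfl
  have hsym : ∀ x y, inner ℂ (R x) y = inner ℂ x (R y) := fun x y => hRpos.isSymmetric x y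
  have hGsa : IsSelfAdjoint G := isSelfAdjoint_starProjection _
  have hGsym : ∀ x y, inner ℂ (G x) y = inner ℂ x (G y) := fun x y =>
    (ContinuousLinearMap.isSelfAdjoint_iff_isSymmetric.1 hGsa) x y
  have hGidem : ∀ x, G (G x) = G x := fun x =>
    Submodule.starProjection_eq_self_iff.2 (Submodule.starProjection_apply_mem _ x)
  have hSadj : ContinuousLinearMap.adjoint (R ∘L G ∘L R) = R ∘L G ∘L R := by
    simp only [ContinuousLinearMap.adjoint_comp, hRadj]
    rw [show ContinuousLinearMap.adjoint G = G from hGsa]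
    rfl
  have hMn : ∀ y, RCLike.re (inner ℂ (M y) y) = ‖R y‖ ^ 2 := by
    intro y
    rw [← hRR, ContinuousLinearMap.comp_apply, hsym]
    exact inner_self_eq_norm_sq (𝕜 := ℂ) (R y)
  rw [hS]
  refine ⟨⟨hSadj, ?_, ?_⟩, ?_⟩
  · intro x hx
    have h : G (R x) = 0 := by
      rw [hG, Submodule.starProjection_apply_eq_zero_iff]
      exact Submodule.le_orthogonal_orthogonal U ⟨x, hx, rfl⟩
    simp [h]
  · rw [ContinuousLinearMap.le_def, ← hRR]
    refine ContinuousLinearMap.isPositive_def'.2 ⟨?_, fun x => ?_⟩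
    · rw [ContinuousLinearMap.isSelfAdjoint_iff', map_sub, hSadj,
        ContinuousLinearMap.adjoint_comp, hRadj]
    · have h1 : inner ℂ ((R ∘L R - R ∘L G ∘L R) x) x
          = inner ℂ (R x - G (R x)) (R x - G (R x)) := by
        have h3 : inner ℂ (R x - G (R x)) (G (R x)) = 0 := by
          rw [← hGsym, map_sub, hGidem, sub_self, inner_zero_left]
        rw [inner_sub_right, h3, sub_zero, ← hsym]
        simp [map_sub]
      rw [ContinuousLinearMap.reApplyInnerSelf_apply, h1]
      exact inner_self_nonneg
  · rintro S' ⟨hS'sa, hS'V, hle⟩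
    rw [ContinuousLinearMap.le_def] at hle ⊢
    refine ContinuousLinearMap.isPositive_def'.2
      ⟨IsSelfAdjoint.sub (show IsSelfAdjoint (R ∘L G ∘L R) from hSadj) hS'sa, fun x => ?_⟩
    have hval : ∀ g ∈ V, inner ℂ (S' (x - g)) (x - g) = inner ℂ (S' x) x := by
      intro g hg
      have hs : ∀ u v, inner ℂ (S' u) v = inner ℂ u (S' v) := fun u v =>
        (ContinuousLinearMap.isSelfAdjoint_iff_isSymmetric.1 hS'sa) u v
      rw [map_sub, hS'V g hg, sub_zero, inner_sub_right, hs x g, hS'V g hg,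
        inner_zero_right, sub_zero]
    have hbd : ∀ y ∈ (U : Set E), RCLike.re (inner ℂ (S' x) x) ≤ ‖R x - y‖ ^ 2 := by
      rintro _ ⟨g, hg, rfl⟩
      have h := hle.re_inner_nonneg_left (x - g)
      rw [sub_apply, inner_sub_left, map_sub, hMn, hval g hg, map_sub] at h
      exact sub_nonneg.1 h
    have hclosed : IsClosed {y : E | RCLike.re (inner ℂ (S' x) x) ≤ ‖R x - y‖ ^ 2} :=
      isClosed_le continuous_const (by fun_prop)
    have hmem : R x - G (R x) ∈ closure (U : Set E) := by
      rw [← Submodule.topologicalClosure_coe, ← Submodule.orthogonal_orthogonal_eq_closure]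
      exact Submodule.sub_starProjection_mem_orthogonal (R x)
    have hfin : RCLike.re (inner ℂ (S' x) x) ≤ ‖R x - (R x - G (R x))‖ ^ 2 :=
      closure_minimal hbd hclosed hmem
    rw [sub_sub_cancel] at hfin
    have h4 : RCLike.re (inner ℂ ((R ∘L G ∘L R) x) x) = ‖G (R x)‖ ^ 2 := by
      rw [ContinuousLinearMap.comp_apply, ContinuousLinearMap.comp_apply, hsym,
        ← hGidem, hGsym, hGidem]
      exact inner_self_eq_norm_sq (𝕜 := ℂ) (G (R x))
    rw [ContinuousLinearMap.reApplyInnerSelf_apply, sub_apply,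
      inner_sub_left, map_sub, h4]
    exact sub_nonneg.2 hfin

theorem supported_iff {P P' : E →L[ℂ] E} (hP : IsSelfAdjoint P) (hadd : ∀ x, P x + P' x = x)
    (hzero : ∀ x, P (P' x) = 0) {S : E →L[ℂ] E} (hS : IsSelfAdjoint S) :
    P ∘L S ∘L P = S ↔ ∀ x ∈ LinearMap.range P'.toLinearMap, S x = 0 := by
  constructor
  · rintro h _ ⟨g, rfl⟩
    rw [← h]
    simp [hzero]
  · intro h
    have hright : S ∘L P = S := by
      ext1 x
      have h1 := congrArg S (hadd x)
      rw [map_add, h (P' x) ⟨x, rfl⟩, add_zero] at h1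
      exact h1
    have hleft : P ∘L S = S := by
      have h1 := congrArg ContinuousLinearMap.adjoint hright
      rwa [ContinuousLinearMap.adjoint_comp, show ContinuousLinearMap.adjoint S = S from hS,
        show ContinuousLinearMap.adjoint P = P from hP] at h1
    rw [hright, hleft]

end Shorted

section General

variable {ι : Type*} {H : Type*} [NormedAddCommGroup H] [InnerProductSpace ℂ H]

/-- The family `i ↦ a (f (σ i))`, read as `0` where `σ` is undefined. -/
def partialComp (σ : ι → Option ι) (a : H →L[ℂ] H) (f : ι → H) (i : ι) : H :=
  (σ i).elim 0 (fun j => a (f j))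

theorem partialComp_add (σ : ι → Option ι) (a : H →L[ℂ] H) (f g : ι → H) (i : ι) :
    partialComp σ a (f + g) i = partialComp σ a f i + partialComp σ a g i := by
  cases h : σ i <;> simp [partialComp, h]

theorem partialComp_smul (σ : ι → Option ι) (a : H →L[ℂ] H) (c : ℂ) (f : ι → H) (i : ι) :
    partialComp σ a (c • f) i = c • partialComp σ a f i := by
  cases h : σ i <;> simp [partialComp, h]

theorem summable_partialComp (σ : ι → Option ι)
    (hσ : ∀ i i' j, σ i = some j → σ i' = some j → i = i') (a : H →L[ℂ] H) (f : EllTwo ι H) :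
    Summable (fun i => ‖partialComp σ a f i‖ ^ 2) ∧
      ∑' i, ‖partialComp σ a f i‖ ^ 2 ≤ ‖a‖ ^ 2 * ‖f‖ ^ 2 := by
  classical
  have hp : 0 < (2 : ℝ≥0∞).toReal := by norm_num
  have key : ∀ s : Finset ι,
      ∑ i ∈ s, ‖partialComp σ a f i‖ ^ 2 ≤ ‖a‖ ^ 2 * ‖f‖ ^ 2 := by
    intro s
    have h1 : ∑ i ∈ s, ‖partialComp σ a f i‖ ^ 2
        = ∑ i ∈ s with (σ i).isSome, ‖partialComp σ a f i‖ ^ 2 := by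
      rw [Finset.sum_filter]
      refine Finset.sum_congr rfl fun i _ => ?_
      cases h : σ i <;> simp [partialComp, h]
    have h2 : ∑ i ∈ s with (σ i).isSome, ‖partialComp σ a f i‖ ^ 2
        ≤ ∑ i ∈ s with (σ i).isSome, ‖a‖ ^ 2 * ‖f ((σ i).getD i)‖ ^ 2 := by
      refine Finset.sum_le_sum fun i hi => ?_
      obtain ⟨j, hj⟩ := Option.isSome_iff_exists.1 (Finset.mem_filter.1 hi).2
      simp only [partialComp, hj, Option.elim_some, Option.getD_some]
      rw [← mul_pow]
      exact pow_le_pow_left₀ (norm_nonneg _) (a.le_opNorm _) 2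
    have hinj : Set.InjOn (fun i => (σ i).getD i)
        ((s.filter fun i => (σ i).isSome : Finset ι) : Set ι) := by
      intro i hi i' hi' hii
      obtain ⟨j, hj⟩ := Option.isSome_iff_exists.1 (Finset.mem_filter.1 hi).2
      obtain ⟨j', hj'⟩ := Option.isSome_iff_exists.1 (Finset.mem_filter.1 hi').2
      simp only [hj, hj', Option.getD_some] at hii
      subst hii
      exact hσ i i' j hj hj'
    have h3 : ∑ i ∈ s with (σ i).isSome, ‖a‖ ^ 2 * ‖f ((σ i).getD i)‖ ^ 2
        = ‖a‖ ^ 2 * ∑ j ∈ (s.filter fun i => (σ i).isSome).image (fun i => (σ i).getD i),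
            ‖f j‖ ^ 2 := by
      rw [Finset.sum_image hinj, Finset.mul_sum]
    have h4 : ∑ j ∈ (s.filter fun i => (σ i).isSome).image (fun i => (σ i).getD i),
        ‖f j‖ ^ 2 ≤ ‖f‖ ^ 2 := by
      have := lp.sum_rpow_le_norm_rpow hp f
        ((s.filter fun i => (σ i).isSome).image (fun i => (σ i).getD i))
      simpa using this
    rw [h1]
    refine h2.trans ?_
    rw [h3]
    exact mul_le_mul_of_nonneg_left h4 (by positivity)
  have hs := summable_of_sum_le (f := fun i => ‖partialComp σ a f i‖ ^ 2)
    (fun i => by positivity) key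
  exact ⟨hs, hs.tsum_le_of_sum_le key⟩

/-- For a partial injection `σ` of the index set and a bounded operator `a` on `H`, the bounded
operator on `ℓ²(ι; H)` given by `(f i)_i ↦ (a (f (σ i)))_i`, with entry `0` where `σ i` is
undefined. -/
def coordMap (σ : ι → Option ι) (hσ : ∀ i i' j, σ i = some j → σ i' = some j → i = i')
    (a : H →L[ℂ] H) : EllTwo ι H →L[ℂ] EllTwo ι H :=
  LinearMap.mkContinuous
    { toFun := fun f => ⟨partialComp σ a f, memℓp_gen (by
        simpa using (summable_partialComp σ hσ a f).1)⟩
      map_add' := fun f g => by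
        ext i
        exact partialComp_add σ a f g i
      map_smul' := fun c f => by
        ext i
        exact partialComp_smul σ a c f i }
    ‖a‖
    (fun f => by
      have hp : 0 < (2 : ℝ≥0∞).toReal := by norm_num
      refine (sq_le_sq₀ (norm_nonneg _) (by positivity)).1 ?_
      have h := lp.norm_rpow_eq_tsum hp
        (⟨partialComp σ a f, memℓp_gen (by
          simpa using (summable_partialComp σ hσ a f).1)⟩ : EllTwo ι H)
      rw [mul_pow]
      refine le_trans (le_of_eq ?_) (summable_partialComp σ hσ a f).2
      simpa using h)

theorem coordMap_apply (σ : ι → Option ι)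
    (hσ : ∀ i i' j, σ i = some j → σ i' = some j → i = i') (a : H →L[ℂ] H)
    (f : EllTwo ι H) (i : ι) :
    coordMap σ hσ a f i = (σ i).elim 0 (fun j => a (f j)) := rfl

open Classical in
/-- The coordinate projection `Π_Λ` of `ℓ²(ι; H)`: it keeps the entries with index in `Λ` and
replaces the other entries by `0`. -/
def coordProj (Λ : Set ι) : EllTwo ι H →L[ℂ] EllTwo ι H :=
  coordMap (fun i => if i ∈ Λ then some i else none)
    (by
      intro i i' j h h'
      split_ifs at h h'
      exact (Option.some.inj h).trans (Option.some.inj h').symm)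
    (ContinuousLinearMap.id ℂ H)

open Classical in
theorem coordProj_apply (Λ : Set ι) (f : EllTwo ι H) (i : ι) :
    coordProj Λ f i = if i ∈ Λ then f i else 0 := by
  unfold coordProj
  rw [coordMap_apply]
  split_ifs <;> simp

/-- The Schur complement `S(M; Λ)`, supported on the rows and columns indexed by `Λ` and padded
with zeros, of a positive semidefinite operator `M` on `ℓ²(ι; H)`: the
operator `M^{1/2} G M^{1/2}`, where `G` is the orthogonal projection onto the orthogonal complement
of `M^{1/2} (ran Π_{Λᶜ})`. It is the largest operator
supported on `Λ` that is `≤ M`, see `schurComplement_isGreatest`. -/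
def schurComplement [CompleteSpace H] (M : EllTwo ι H →L[ℂ] EllTwo ι H) (Λ : Set ι) :
    EllTwo ι H →L[ℂ] EllTwo ι H :=
  shortedOperator M (LinearMap.range (coordProj (H := H) Λᶜ).toLinearMap)

end General

section Torus

variable {d : ℕ} {H : Type*} [NormedAddCommGroup H] [InnerProductSpace ℂ H]

/-- The Hardy space `H²` of `H`-valued functions on the polydisc `𝔻^d`; a function
`f(z) = ∑ f_k z^k` is identified with the square summable family `(f_k)` of its Taylor
coefficients, `k ∈ ℕ^d`. -/
abbrev Hardy (d : ℕ) (H : Type*) [NormedAddCommGroup H] : Type _ :=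
  EllTwo (Fin d → ℕ) H

/-- Operator-valued trigonometric polynomials `A(z) = ∑_k A_k z^k` in `d` variables, given by
their finitely many nonzero coefficients `A_k`, `k ∈ ℤ^d`. -/
abbrev OpTrigPoly (d : ℕ) (H : Type*) [NormedAddCommGroup H] [InnerProductSpace ℂ H] : Type _ :=
  (Fin d → ℤ) →₀ (H →L[ℂ] H)

/-- The inclusion `ℕ^d ⊆ ℤ^d`. -/
def toInt (k : Fin d → ℕ) : Fin d → ℤ := fun t => (k t : ℤ)

/-- The monomial `z^k = z_1^{k_1} ⋯ z_d^{k_d}` at a point of the torus `𝕋^d`. -/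
def monomial (z : Fin d → Circle) (k : Fin d → ℤ) : ℂ := ∏ t, (z t : ℂ) ^ (k t)

/-- The value `A(z) = ∑_k A_k z^k` at a point of the torus `𝕋^d`. -/
def evalTorus (A : OpTrigPoly d H) (z : Fin d → Circle) : H →L[ℂ] H :=
  ∑ k ∈ A.support, monomial z k • A k

/-- `i ↦ i - k` as a partial map of `ℕ^d`, defined when all entries of `i - k` are nonnegative. -/
def shiftIndex (k : Fin d → ℤ) (i : Fin d → ℕ) : Option (Fin d → ℕ) :=
  if ∀ t, k t ≤ (i t : ℤ) then some (fun t => ((i t : ℤ) - k t).toNat) else none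

theorem shiftIndex_eq_some (k : Fin d → ℤ) (i j : Fin d → ℕ) :
    shiftIndex k i = some j ↔ toInt i - toInt j = k := by
  unfold shiftIndex
  constructor
  · intro h
    split_ifs at h with hk
    have h := Option.some.inj h
    funext t
    have := congrFun h t
    have := hk t
    simp only [toInt, Pi.sub_apply]
    omega
  · intro h
    have h' : ∀ t, (i t : ℤ) - (j t : ℤ) = k t := fun t => congrFun h t
    rw [if_pos (fun t => by have := h' t; omega)]
    congr 1
    funext t
    have := h' t
    omega

theorem shiftIndex_injective (k : Fin d → ℤ) (i i' j : Fin d → ℕ)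
    (h : shiftIndex k i = some j) (h' : shiftIndex k i' = some j) : i = i' := by
  rw [shiftIndex_eq_some] at h h'
  funext t
  have h1 := congrFun h t
  have h2 := congrFun h' t
  simp only [toInt, Pi.sub_apply] at h1 h2
  omega

/-- The Toeplitz operator `T_A` on the Hardy space with symbol a trigonometric polynomial `A`:
`(T_A f)_i = ∑_k A_k f_{i-k}`, where `f_j = 0` for `j ∉ ℕ^d`. -/
def toeplitz (A : OpTrigPoly d H) : Hardy d H →L[ℂ] Hardy d H :=
  ∑ k ∈ A.support, coordMap (shiftIndex k) (shiftIndex_injective k) (A k)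

/-- The matrix of `T_A` has the entry `A_{i-j}` in row `i` and column `j`. -/
theorem toeplitz_single (A : OpTrigPoly d H) (i j : Fin d → ℕ) (x : H) :
    toeplitz A (lp.single 2 j x) i = A (toInt i - toInt j) x := by
  have h0 : toeplitz A (lp.single 2 j x) i
      = ∑ k ∈ A.support, coordMap (shiftIndex k) (shiftIndex_injective k) (A k)
          (lp.single 2 j x) i := by
    simp only [toeplitz, sum_apply, lp.coeFn_sum]
    exact Finset.sum_apply i A.support _
  rw [h0]
  have hterm : ∀ k, coordMap (shiftIndex k) (shiftIndex_injective k) (A k)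
      (lp.single 2 j x) i = if toInt i - toInt j = k then A k x else 0 := by
    intro k
    rw [coordMap_apply]
    split_ifs with hk
    · rw [(shiftIndex_eq_some k i j).2 hk]
      simp
    · cases h : shiftIndex k i with
      | none => simp
      | some j' =>
        have hne : j' ≠ j := by
          rintro rfl
          exact hk ((shiftIndex_eq_some k i j').1 h)
        simp [hne]
  simp only [hterm, Finset.sum_ite_eq]
  split_ifs with hm
  · rfl
  · simp [Finsupp.notMem_support_iff.1 hm]

/-- The index set `K = ∏_t {0, …, n_t} ⊆ ℕ^d`. -/
def box (n : Fin d → ℕ) : Finset (Fin d → ℕ) := Finset.Icc 0 n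

/-- The column `Z_K = (z^{n-k})_{k ∈ K}`, as the operator from `H` to the Hardy space that sends
`x` to the family with the entry `z^{n-k} x` at `k ∈ K` and `0` elsewhere. -/
def zColumn (n : Fin d → ℕ) (z : Fin d → Circle) : H →L[ℂ] Hardy d H :=
  ∑ k ∈ box n, monomial z (toInt n - toInt k) •
    lp.singleContinuousLinearMap ℂ (fun _ : Fin d → ℕ => H) 2 k

end Torus

section SchurFacts

variable {ι : Type*} {H : Type*} [NormedAddCommGroup H] [InnerProductSpace ℂ H]

theorem coordProj_add_compl (Λ : Set ι) (f : EllTwo ι H) :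
    coordProj Λ f + coordProj Λᶜ f = f := by
  classical
  ext i
  by_cases h : i ∈ Λ <;> simp [coordProj_apply, h]

theorem coordProj_coordProj_compl (Λ : Set ι) (f : EllTwo ι H) :
    coordProj Λ (coordProj Λᶜ f) = 0 := by
  classical
  ext i
  by_cases h : i ∈ Λ <;> simp [coordProj_apply, h]

variable [CompleteSpace H]

theorem coordProj_isSelfAdjoint (Λ : Set ι) :
    IsSelfAdjoint (coordProj Λ : EllTwo ι H →L[ℂ] EllTwo ι H) := by
  classical
  rw [ContinuousLinearMap.isSelfAdjoint_iff_isSymmetric]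
  intro f g
  simp only [ContinuousLinearMap.coe_coe, lp.inner_eq_tsum]
  refine tsum_congr fun i => ?_
  by_cases h : i ∈ Λ <;> simp [coordProj_apply, h]

/-- For `M ≥ 0` the Schur complement is the largest self-adjoint operator supported on `Λ` (rows
and columns) that is at most `M`. -/
theorem schurComplement_isGreatest (M : EllTwo ι H →L[ℂ] EllTwo ι H) (hM : 0 ≤ M) (Λ : Set ι) :
    IsGreatest {S : EllTwo ι H →L[ℂ] EllTwo ι H |
      IsSelfAdjoint S ∧ coordProj Λ ∘L S ∘L coordProj Λ = S ∧ S ≤ M}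
      (schurComplement M Λ) := by
  have hiff : ∀ S : EllTwo ι H →L[ℂ] EllTwo ι H, IsSelfAdjoint S →
      (coordProj Λ ∘L S ∘L coordProj Λ = S ↔
        ∀ x ∈ LinearMap.range (coordProj (H := H) Λᶜ).toLinearMap, S x = 0) := fun S hS =>
    supported_iff (coordProj_isSelfAdjoint Λ) (coordProj_add_compl Λ)
      (coordProj_coordProj_compl Λ) hS
  have h := shortedOperator_isGreatest M hM
    (LinearMap.range (coordProj (H := H) Λᶜ).toLinearMap)
  refine ⟨⟨h.1.1, (hiff _ h.1.1).2 h.1.2.1, h.1.2.2⟩, ?_⟩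
  rintro S ⟨hS, hsupp, hle⟩
  exact h.2 ⟨hS, (hiff S hS).1 hsupp, hle⟩

end SchurFacts

end OuterFactorization

end

noncomputable section

namespace OuterFactorization


/-! ### Shorted operators computed from an arbitrary factorization -/

section Abstract

variable {E F G : Type*} [NormedAddCommGroup E] [InnerProductSpace ℂ E]
  [NormedAddCommGroup F] [InnerProductSpace ℂ F] [CompleteSpace F]
  [NormedAddCommGroup G] [InnerProductSpace ℂ G] [CompleteSpace G]

/-! The point is to read `Y` as `L* L` for a single row `L` with values in `H`. A Schur complement
of `T* T` is `T* G T`, where `G` projects onto `(T V)ᗮ`, for any factor `T` and not just the square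
root (`shortedOperator_adjoint_comp_self`). Passing from `K` to `K \ {n}` enlarges `V` by the
coordinate space at `n`, so by Gram–Schmidt `Y = T* P_W T`, where `W` is the closure of the image of
that space under `G T` (`adjoint_comp_starProjection_sub`).

If `P` is as in (i), then `T_Q = T_P* T_P`, as `P` is analytic. Since `K` is a lower set with top
`n`, column `n` of `T_P` is `P_0` in row `n` plus a remainder in the rows outside `K`. The column
condition says that `G` kills this remainder, and the range condition that row `n` of `T_P` takes
values in the closure of `ran P_0`. So `L` is row `n` of `T_P`, and `L Z_K(z) = P(z)`.

Conversely, `W` is the closed range of an operator defined on `H`, so it embeds isometrically into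
`H`; this gives `Y = L* L` with `ran L` in the closure of the range of `L` on coordinate `n`
(`exists_row_factorization`). The polynomial with `P_k = L_{n-k}` satisfies `P(z) = L Z_K(z)`, so
(ii) says `Q = P* P`. Computing the `(n, n)` entry of `Y` through `T_P` as well leaves no room for
the projected remainder, which yields the column condition. -/

theorem isGLB_norm_starProjection_orthogonal (T : E →L[ℂ] F) (V : Submodule ℂ E) (f : E) :
    IsGLB (Set.range fun g : V => ‖T (f + g)‖)
      ‖(V.map T.toLinearMap)ᗮ.starProjection (T f)‖ := by
  set U := V.map T.toLinearMap with hU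
  constructor
  · rintro _ ⟨g, rfl⟩
    have h : Uᗮ.starProjection (T (f + g)) = Uᗮ.starProjection (T f) := by
      rw [map_add, map_add, add_eq_left, Submodule.starProjection_apply_eq_zero_iff]
      exact Submodule.le_orthogonal_orthogonal U ⟨g, g.2, rfl⟩
    rw [← h]
    exact Submodule.norm_starProjection_apply_le _ _
  · intro c hc
    -- The infimum need not be attained on `U`, but a lower bound persists on the closure, which
    -- contains the nearest point to `T f`.
    have hclosed : IsClosed {y : F | c ≤ ‖T f - y‖} := isClosed_le continuous_const (by fun_prop)
    have hbd : ∀ y ∈ (U : Set F), c ≤ ‖T f - y‖ := by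
      rintro _ ⟨g, hg, rfl⟩
      have := hc ⟨⟨-g, neg_mem hg⟩, rfl⟩
      simpa [sub_eq_add_neg] using this
    have hmem : T f - Uᗮ.starProjection (T f) ∈ closure (U : Set F) := by
      rw [← Submodule.topologicalClosure_coe, ← Submodule.orthogonal_orthogonal_eq_closure]
      exact Submodule.sub_starProjection_mem_orthogonal _
    have h : c ≤ ‖T f - (T f - Uᗮ.starProjection (T f))‖ := closure_minimal hbd hclosed hmem
    rwa [sub_sub_cancel] at h

variable [CompleteSpace E]

/-- Gram–Schmidt for subspaces: the closure of `U ⊔ X` is the orthogonal sum of the closure of `U`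
and the closure of the part of `X` orthogonal to `U`. -/
theorem starProjection_orthogonal_sub_sup (U X : Submodule ℂ E) :
    Uᗮ.starProjection - (U ⊔ X)ᗮ.starProjection
      = (X.map Uᗮ.starProjection.toLinearMap)ᗮᗮ.starProjection := by
  set W := (X.map Uᗮ.starProjection.toLinearMap)ᗮᗮ with hW
  have hWU : W ≤ Uᗮ := by
    refine (Submodule.orthogonal_le (Submodule.orthogonal_le ?_)).trans
      (Submodule.triorthogonal_eq_orthogonal (K := U)).le
    rintro _ ⟨x, -, rfl⟩
    exact Submodule.starProjection_apply_mem _ x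
  have hsub : ∀ y, y - Uᗮ.starProjection y ∈ (U ⊔ X)ᗮᗮ := fun y =>
    Submodule.orthogonal_le (Submodule.orthogonal_le le_sup_left)
      (Submodule.sub_starProjection_mem_orthogonal y)
  have hWsup : W ≤ (U ⊔ X)ᗮᗮ := by
    refine (Submodule.orthogonal_le (Submodule.orthogonal_le ?_)).trans
      (Submodule.triorthogonal_eq_orthogonal (K := (U ⊔ X)ᗮ)).le
    rintro _ ⟨x, hx, rfl⟩
    have h1 : x ∈ (U ⊔ X)ᗮᗮ :=
      Submodule.le_orthogonal_orthogonal _ (Submodule.mem_sup_right hx)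
    have h2 := sub_mem h1 (hsub x)
    rwa [sub_sub_cancel] at h2
  ext y
  rw [sub_apply, sub_eq_iff_eq_add, ← sub_eq_iff_eq_add']
  symm
  apply Submodule.eq_starProjection_of_mem_orthogonal
  · rw [← Submodule.inf_orthogonal]
    have hmem : Uᗮ.starProjection y - W.starProjection y ∈ Uᗮ :=
      sub_mem (Submodule.starProjection_apply_mem _ y)
        (hWU (Submodule.starProjection_apply_mem _ y))
    refine ⟨hmem, (Submodule.mem_orthogonal' _ _).2 fun x hx => ?_⟩
    have h1 : inner ℂ (Uᗮ.starProjection y - W.starProjection y) x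
        = inner ℂ (y - W.starProjection y) (Uᗮ.starProjection x) := by
      have h2 := Submodule.starProjection_eq_self_iff.2 hmem
      rw [← h2, Submodule.inner_starProjection_left_eq_right, inner_sub_left, inner_sub_left,
        Submodule.inner_starProjection_left_eq_right,
        Submodule.starProjection_eq_self_iff.2 (Submodule.starProjection_apply_mem _ x)]
    rw [h1]
    exact Submodule.starProjection_inner_eq_zero _ _
      (Submodule.le_orthogonal_orthogonal _ ⟨x, hx, rfl⟩)
  · have h := add_mem (hsub y) (hWsup (Submodule.starProjection_apply_mem W y))
    rwa [sub_add] at h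

theorem inner_adjoint_starProjection (T : E →L[ℂ] F) (U : Submodule ℂ F)
    [U.HasOrthogonalProjection] (x : E) :
    inner ℂ ((ContinuousLinearMap.adjoint T ∘L U.starProjection ∘L T) x) x
      = ((‖U.starProjection (T x)‖ ^ 2 : ℝ) : ℂ) := by
  rw [ContinuousLinearMap.comp_apply, ContinuousLinearMap.adjoint_inner_left,
    ContinuousLinearMap.comp_apply,
    ← Submodule.starProjection_eq_self_iff.2 (Submodule.starProjection_apply_mem U (T x)),
    Submodule.inner_starProjection_left_eq_right,
    Submodule.starProjection_eq_self_iff.2 (Submodule.starProjection_apply_mem U (T x)),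
    inner_self_eq_norm_sq_to_K]
  norm_cast

theorem adjoint_sqrt (M : E →L[ℂ] E) : ContinuousLinearMap.adjoint (CFC.sqrt M) = CFC.sqrt M :=
  ((ContinuousLinearMap.nonneg_iff_isPositive _).1 (CFC.sqrt_nonneg M)).isSelfAdjoint

/-- The shorted operator can be computed from any factorization `M = T* T`. -/
theorem shortedOperator_adjoint_comp_self (T : E →L[ℂ] F) (V : Submodule ℂ E) :
    shortedOperator (ContinuousLinearMap.adjoint T ∘L T) V
      = ContinuousLinearMap.adjoint T ∘L (V.map T.toLinearMap)ᗮ.starProjection ∘L T := by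
  set M := ContinuousLinearMap.adjoint T ∘L T with hMdef
  have hM : 0 ≤ M := (ContinuousLinearMap.nonneg_iff_isPositive _).2
    (ContinuousLinearMap.isPositive_adjoint_comp_self T)
  have hRR : CFC.sqrt M ∘L CFC.sqrt M = M := CFC.sqrt_mul_sqrt_self M hM
  have hnorm : ∀ x, ‖CFC.sqrt M x‖ = ‖T x‖ := by
    intro x
    have h1 : inner ℂ (CFC.sqrt M x) (CFC.sqrt M x) = inner ℂ (T x) (T x) := by
      rw [← ContinuousLinearMap.adjoint_inner_left, adjoint_sqrt,
        ← ContinuousLinearMap.comp_apply, hRR, hMdef, ContinuousLinearMap.comp_apply,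
        ContinuousLinearMap.adjoint_inner_left]
    rw [inner_self_eq_norm_sq_to_K, inner_self_eq_norm_sq_to_K] at h1
    have h2 : ‖CFC.sqrt M x‖ ^ 2 = ‖T x‖ ^ 2 := by exact_mod_cast h1
    exact (sq_eq_sq₀ (norm_nonneg _) (norm_nonneg _)).1 h2
  have hS : shortedOperator M V = ContinuousLinearMap.adjoint (CFC.sqrt M) ∘L
      (V.map (CFC.sqrt M).toLinearMap)ᗮ.starProjection ∘L CFC.sqrt M := by
    rw [adjoint_sqrt]; rfl
  refine ContinuousLinearMap.coe_injective ((ext_inner_map _ _).1 fun x => ?_)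
  simp only [ContinuousLinearMap.coe_coe]
  rw [hS, inner_adjoint_starProjection, inner_adjoint_starProjection]
  -- Each quadratic form is the square of an infimum of norms, and the norms agree for `CFC.sqrt M`
  -- and `T`.
  have h1 := isGLB_norm_starProjection_orthogonal (CFC.sqrt M) V x
  simp only [hnorm] at h1
  rw [h1.unique (isGLB_norm_starProjection_orthogonal T V x)]

/-- The difference of the shorted operators of `T* T` for the subspaces `V ≤ V ⊔ X`. -/
theorem adjoint_comp_starProjection_sub (T : E →L[ℂ] F) (V X : Submodule ℂ E) :
    ContinuousLinearMap.adjoint T ∘L (V.map T.toLinearMap)ᗮ.starProjection ∘L T -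
        ContinuousLinearMap.adjoint T ∘L ((V ⊔ X).map T.toLinearMap)ᗮ.starProjection ∘L T
      = ContinuousLinearMap.adjoint T ∘L ((X.map T.toLinearMap).map
          (V.map T.toLinearMap)ᗮ.starProjection.toLinearMap)ᗮᗮ.starProjection ∘L T := by
  rw [Submodule.map_sup, ← starProjection_orthogonal_sub_sup, ContinuousLinearMap.sub_comp,
    ContinuousLinearMap.comp_sub]

/-- The closure of the range of `B : H → E` embeds isometrically into `H`. -/
theorem exists_adjoint_comp_self_eq_starProjection (B : G →L[ℂ] E) :
    ∃ U : E →L[ℂ] G,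
      ContinuousLinearMap.adjoint U ∘L U = (LinearMap.range B.toLinearMap)ᗮᗮ.starProjection := by
  set W := (LinearMap.range B.toLinearMap)ᗮᗮ with hW
  have hBW : ∀ x, B x ∈ W := fun x => Submodule.le_orthogonal_orthogonal _ ⟨x, rfl⟩
  set e : G →ₗ[ℂ] W := B.toLinearMap.codRestrict W hBW with he
  -- Polar decomposition: `C = |B|` acts inside `G`, and `B x ↦ C x` is isometric, so it extends to
  -- the closure of `ran B`.
  set C : G →L[ℂ] G := CFC.sqrt (ContinuousLinearMap.adjoint B ∘L B) with hC
  have hM : 0 ≤ ContinuousLinearMap.adjoint B ∘L B :=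
    (ContinuousLinearMap.nonneg_iff_isPositive _).2
      (ContinuousLinearMap.isPositive_adjoint_comp_self B)
  have hCC : C ∘L C = ContinuousLinearMap.adjoint B ∘L B := CFC.sqrt_mul_sqrt_self _ hM
  have hnorm : ∀ x, ‖C x‖ = ‖e x‖ := by
    intro x
    have h1 : inner ℂ (C x) (C x) = inner ℂ (B x) (B x) := by
      rw [← ContinuousLinearMap.adjoint_inner_left, hC, adjoint_sqrt, ← hC,
        ← ContinuousLinearMap.comp_apply, hCC, ContinuousLinearMap.comp_apply,
        ContinuousLinearMap.adjoint_inner_left]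
    rw [inner_self_eq_norm_sq_to_K, inner_self_eq_norm_sq_to_K] at h1
    have h2 : ‖C x‖ ^ 2 = ‖B x‖ ^ 2 := by exact_mod_cast h1
    exact (sq_eq_sq₀ (norm_nonneg _) (norm_nonneg _)).1 h2
  have hdense : DenseRange e := by
    intro w
    rw [closure_subtype]
    have h1 : ((↑) : W → E) '' Set.range e = (LinearMap.range B.toLinearMap : Set E) := by
      ext y
      simp [he]
    rw [h1, ← Submodule.topologicalClosure_coe, ← Submodule.orthogonal_orthogonal_eq_closure]
    exact w.2
  set u : W →L[ℂ] G := C.toLinearMap.extendOfNorm e with hu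
  have hue : ∀ x, u (e x) = C x := fun x =>
    LinearMap.extendOfNorm_eq hdense ⟨1, fun y => by simp [hnorm y]⟩ x
  have hiso : ∀ w, ‖u w‖ = ‖w‖ := by
    intro w
    refine hdense.induction_on (p := fun w => ‖u w‖ = ‖w‖) w
      (isClosed_eq (by fun_prop) (by fun_prop)) fun x => ?_
    rw [hue, hnorm]
  refine ⟨u ∘L W.orthogonalProjectionOnto, ContinuousLinearMap.coe_injective
    ((ext_inner_map _ _).1 fun x => ?_)⟩
  simp only [ContinuousLinearMap.coe_coe]
  rw [ContinuousLinearMap.comp_apply, ContinuousLinearMap.adjoint_inner_left,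
    inner_self_eq_norm_sq_to_K, ContinuousLinearMap.comp_apply, hiso]
  have h := inner_adjoint_starProjection (ContinuousLinearMap.id ℂ E) W x
  rw [ContinuousLinearMap.adjoint_id] at h
  simp only [ContinuousLinearMap.id_comp, ContinuousLinearMap.comp_id,
    ContinuousLinearMap.id_apply] at h
  rw [h, Submodule.starProjection_apply]
  norm_cast

/-- Such a `U` is a partial isometry whose initial space is the closure of `X`. -/
theorem range_subset_closure_of_adjoint_comp_self (U : E →L[ℂ] G) (X : Submodule ℂ E)
    (hU : ContinuousLinearMap.adjoint U ∘L U = Xᗮᗮ.starProjection) :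
    Set.range U ⊆ closure (U '' X) ∧ ∀ y ∈ Xᗮ, U y = 0 := by
  have hzero : ∀ y ∈ Xᗮ, U y = 0 := by
    intro y hy
    rw [← inner_self_eq_zero (𝕜 := ℂ), ← ContinuousLinearMap.adjoint_inner_left,
      ← ContinuousLinearMap.comp_apply, hU, Submodule.starProjection_orthogonal_apply_eq_zero hy,
      inner_zero_left]
  refine ⟨?_, hzero⟩
  rintro _ ⟨y, rfl⟩
  have h1 : Xᗮᗮ.starProjection y ∈ closure (X : Set E) := by
    rw [← Submodule.topologicalClosure_coe, ← Submodule.orthogonal_orthogonal_eq_closure]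
    exact Submodule.starProjection_apply_mem _ _
  have h2 : U y = U (Xᗮᗮ.starProjection y) := by
    rw [← sub_eq_zero, ← map_sub]
    apply hzero
    exact (Submodule.triorthogonal_eq_orthogonal (K := X)).le
      (Submodule.sub_starProjection_mem_orthogonal _)
  rw [h2]
  exact image_closure_subset_closure_image U.continuous ⟨_, h1, rfl⟩

end Abstract


/-! ### Toeplitz operators and trigonometric polynomials -/

section CoordMap

variable {ι H : Type*} [NormedAddCommGroup H] [InnerProductSpace ℂ H]

theorem coordMap_zero (σ : ι → Option ι) (hσ : ∀ i i' j, σ i = some j → σ i' = some j → i = i') :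
    coordMap σ hσ (0 : H →L[ℂ] H) = 0 := by
  ext f i
  rw [coordMap_apply]
  cases σ i <;> simp

theorem coordMap_add (σ : ι → Option ι) (hσ : ∀ i i' j, σ i = some j → σ i' = some j → i = i')
    (a b : H →L[ℂ] H) : coordMap σ hσ (a + b) = coordMap σ hσ a + coordMap σ hσ b := by
  ext f i
  rw [add_apply, lp.coeFn_add, Pi.add_apply, coordMap_apply, coordMap_apply, coordMap_apply]
  cases σ i <;> simp

end CoordMap

section Toeplitz

variable {d : ℕ} {H : Type*} [NormedAddCommGroup H] [InnerProductSpace ℂ H]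

/-- The Toeplitz operator as an additive function of its symbol. -/
def toeplitzHom : OpTrigPoly d H →+ (Hardy d H →L[ℂ] Hardy d H) :=
  Finsupp.liftAddHom fun k =>
    { toFun := coordMap (shiftIndex k) (shiftIndex_injective k)
      map_zero' := coordMap_zero _ _
      map_add' := coordMap_add _ _ }

theorem toeplitzHom_apply (A : OpTrigPoly d H) : toeplitzHom A = toeplitz A := rfl

theorem toeplitzHom_single (k : Fin d → ℤ) (a : H →L[ℂ] H) :
    toeplitzHom (Finsupp.single k a) = coordMap (shiftIndex k) (shiftIndex_injective k) a :=
  Finsupp.liftAddHom_apply_single _ _ _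

/-- The value of a trigonometric polynomial at a point of the torus, as an additive map. -/
def evalTorusHom (z : Fin d → Circle) : OpTrigPoly d H →+ (H →L[ℂ] H) :=
  Finsupp.liftAddHom fun k => DistribSMul.toAddMonoidHom (H →L[ℂ] H) (monomial z k)

theorem evalTorusHom_apply (z : Fin d → Circle) (A : OpTrigPoly d H) :
    evalTorusHom z A = evalTorus A z := rfl

theorem evalTorusHom_single (z : Fin d → Circle) (k : Fin d → ℤ) (a : H →L[ℂ] H) :
    evalTorusHom z (Finsupp.single k a) = monomial z k • a :=
  Finsupp.liftAddHom_apply_single _ _ _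

/-- The character `z ↦ z^k` of the torus. -/
def monomialHom (k : Fin d → ℤ) : (Fin d → Circle) →* ℂ where
  toFun z := monomial z k
  map_one' := by simp [monomial]
  map_mul' z w := by simp [monomial, mul_zpow, Finset.prod_mul_distrib]

theorem monomialHom_injective : Function.Injective (monomialHom (d := d)) := by
  intro k l hkl
  funext t
  by_contra hne
  set m : ℤ := k t - l t with hm
  have hm0 : (m : ℂ) ≠ 0 := by exact_mod_cast sub_ne_zero.2 hne
  -- Chosen so that `c ^ m = -1`, whereas equality of the two characters forces `c ^ m = 1`.
  set c : Circle := Circle.exp (Real.pi / m) with hc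
  have heval : ∀ k : Fin d → ℤ,
      monomialHom k (Function.update (1 : Fin d → Circle) t c) = (c : ℂ) ^ k t := by
    intro k
    change ∏ s, (Function.update (1 : Fin d → Circle) t c s : ℂ) ^ k s = _
    rw [Finset.prod_eq_single t]
    · simp
    · intro s _ hs
      simp [Function.update_of_ne hs]
    · simp
  have h1 := DFunLike.congr_fun hkl (Function.update (1 : Fin d → Circle) t c)
  rw [heval, heval] at h1
  have h2 : (c : ℂ) ^ m = 1 := by
    rw [hm, zpow_sub₀ (Circle.coe_ne_zero c), h1, div_self (zpow_ne_zero _ (Circle.coe_ne_zero c))]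
  have h3 : (c : ℂ) ^ m = -1 := by
    rw [hc, Circle.coe_exp, ← Complex.exp_int_mul]
    push_cast
    rw [← Complex.exp_pi_mul_I]
    congr 1
    field_simp
  rw [h2] at h3
  norm_num at h3

/-- Distinct characters are linearly independent (Dedekind); this is applied to the scalar
coefficients `⟨y, D_k x⟩` of the difference. -/
theorem evalTorus_injective {A B : OpTrigPoly d H}
    (h : ∀ z, evalTorus A z = evalTorus B z) : A = B := by
  rw [← sub_eq_zero]
  set D := A - B with hD
  have h0 : ∀ z, evalTorus D z = 0 := fun z => by
    rw [← evalTorusHom_apply, hD, map_sub, evalTorusHom_apply, evalTorusHom_apply, h, sub_self]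
  have hli := (linearIndependent_monoidHom (Fin d → Circle) ℂ).comp _
    (monomialHom_injective (d := d))
  rw [linearIndependent_iff'] at hli
  by_contra hne
  obtain ⟨k, hk⟩ := Finsupp.support_nonempty_iff.2 hne
  refine Finsupp.mem_support_iff.1 hk ?_
  ext x
  rw [zero_apply]
  refine ext_inner_left ℂ fun y => ?_
  rw [inner_zero_right]
  refine hli D.support (fun k => inner ℂ y (D k x)) ?_ k hk
  funext z
  have h2 := congrArg (fun a : H →L[ℂ] H => inner ℂ y (a x)) (h0 z)
  simp only [evalTorus, sum_apply, smul_apply, inner_sum, inner_smul_right, zero_apply,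
    inner_zero_right] at h2
  rw [Finset.sum_apply]
  simp only [Function.comp_apply, Pi.smul_apply, smul_eq_mul, Pi.zero_apply]
  refine Eq.trans (Finset.sum_congr rfl fun k _ => ?_) h2
  exact mul_comm _ _

variable [CompleteSpace H]

theorem shiftIndex_toInt_add (k i : Fin d → ℕ) : shiftIndex (toInt k) (i + k) = some i := by
  rw [shiftIndex_eq_some]
  funext t
  simp [toInt]

/-- For `k ∈ ℕ^d` the shift by `k` loses no entries. Its outputs live on `ℕ^d + k`, so the inner
product can be reindexed by `i ↦ i + k`. This is where analyticity enters. -/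
theorem adjoint_coordMap_shiftIndex_comp (k : Fin d → ℕ) (l : Fin d → ℤ) (a b : H →L[ℂ] H) :
    ContinuousLinearMap.adjoint (coordMap (shiftIndex (toInt k)) (shiftIndex_injective _) a) ∘L
        coordMap (shiftIndex l) (shiftIndex_injective l) b
      = coordMap (shiftIndex (l - toInt k)) (shiftIndex_injective _)
          (ContinuousLinearMap.adjoint a ∘L b) := by
  ext1 f
  refine ext_inner_right ℂ fun g => ?_
  rw [ContinuousLinearMap.comp_apply, ContinuousLinearMap.adjoint_inner_left, lp.inner_eq_tsum,
    lp.inner_eq_tsum]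
  have hinj : Function.Injective fun i : Fin d → ℕ => i + k := add_left_injective k
  rw [← hinj.tsum_eq]
  · refine tsum_congr fun i => ?_
    rw [coordMap_apply, coordMap_apply, coordMap_apply, shiftIndex_toInt_add]
    have hs : shiftIndex l (i + k) = shiftIndex (l - toInt k) i := by
      ext j
      rw [shiftIndex_eq_some, shiftIndex_eq_some, eq_sub_iff_add_eq]
      have : toInt (i + k) = toInt i + toInt k := by
        funext t; simp [toInt]
      rw [this, sub_add_eq_add_sub]
    rw [hs]
    cases shiftIndex (l - toInt k) i with
    | none => simp
    | some j => simp [ContinuousLinearMap.adjoint_inner_left]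
  · intro i hi
    rw [Function.mem_support, coordMap_apply (shiftIndex (toInt k))] at hi
    cases h : shiftIndex (toInt k) i with
    | none => simp [h] at hi
    | some j =>
      refine ⟨j, ?_⟩
      exact shiftIndex_injective (toInt k) _ _ j (shiftIndex_toInt_add k j) h

/-- The coefficients of `P(z)* P(z)` on the torus. -/
def adjointMul (P : OpTrigPoly d H) : OpTrigPoly d H :=
  ∑ k ∈ P.support, ∑ l ∈ P.support,
    Finsupp.single (l - k) (ContinuousLinearMap.adjoint (P k) ∘L P l)

theorem conj_monomial (z : Fin d → Circle) (k : Fin d → ℤ) :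
    (starRingEnd ℂ) (monomial z k) = monomial z (-k) := by
  simp [monomial, map_prod, ← Circle.coe_inv_eq_conj]

theorem monomial_add (z : Fin d → Circle) (k l : Fin d → ℤ) :
    monomial z (k + l) = monomial z k * monomial z l := by
  simp [monomial, zpow_add₀, Finset.prod_mul_distrib]

theorem evalTorus_adjointMul (P : OpTrigPoly d H) (z : Fin d → Circle) :
    evalTorus (adjointMul P) z
      = ContinuousLinearMap.adjoint (evalTorus P z) ∘L evalTorus P z := by
  rw [← evalTorusHom_apply, adjointMul, map_sum]
  simp only [map_sum, evalTorusHom_single]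
  rw [evalTorus, map_sum, ContinuousLinearMap.finsetSum_comp]
  refine Finset.sum_congr rfl fun k _ => ?_
  rw [ContinuousLinearMap.comp_finsetSum]
  refine Finset.sum_congr rfl fun l _ => ?_
  rw [LinearIsometryEquiv.map_smulₛₗ, conj_monomial, ContinuousLinearMap.smul_comp,
    ContinuousLinearMap.comp_smul, smul_smul, sub_eq_neg_add, monomial_add]

/-- If `Q = P* P` on the torus with `P` analytic, then `T_Q = T_P* T_P`. -/
theorem toeplitz_eq_adjoint_comp_self {P Q : OpTrigPoly d H}
    (hP : (P.support : Set (Fin d → ℤ)) ⊆ Set.range toInt)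
    (hPQ : ∀ z, evalTorus Q z = ContinuousLinearMap.adjoint (evalTorus P z) ∘L evalTorus P z) :
    toeplitz Q = ContinuousLinearMap.adjoint (toeplitz P) ∘L toeplitz P := by
  have hQ : Q = adjointMul P :=
    evalTorus_injective fun z => by rw [hPQ, evalTorus_adjointMul]
  rw [hQ, ← toeplitzHom_apply, adjointMul, map_sum]
  simp only [map_sum, toeplitzHom_single]
  rw [toeplitz, map_sum, ContinuousLinearMap.finsetSum_comp]
  refine Finset.sum_congr rfl fun k hk => ?_
  rw [ContinuousLinearMap.comp_finsetSum]
  refine Finset.sum_congr rfl fun l _ => ?_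
  obtain ⟨k, rfl⟩ := hP hk
  rw [adjoint_coordMap_shiftIndex_comp]

end Toeplitz


/-! ### Analytic polynomials with exponents in the box `K` -/

section Box

variable {d : ℕ} {H : Type*} [NormedAddCommGroup H] [InnerProductSpace ℂ H]

theorem toInt_injective : Function.Injective (toInt (d := d)) := fun k l h => by
  funext t
  have := congrFun h t
  simpa [toInt] using this

theorem mem_box {n k : Fin d → ℕ} : k ∈ box n ↔ k ≤ n := by
  simp [box]

/-- The inclusion of the coordinate with index `k` into `ℓ²(ι; H)`. -/
abbrev coordIncl {ι : Type*} [DecidableEq ι] (k : ι) : H →L[ℂ] EllTwo ι H :=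
  lp.singleContinuousLinearMap ℂ (fun _ : ι => H) 2 k

theorem coordProj_singleton {ι : Type*} [DecidableEq ι] (k : ι) (f : EllTwo ι H) :
    coordProj {k} f = coordIncl k (f k) := by
  ext i
  rw [coordProj_apply]
  by_cases h : i = k
  · subst h; simp
  · simp [h]

theorem range_coordProj_compl_diff_singleton {ι : Type*} [DecidableEq ι] (Λ : Set ι) {k : ι}
    (hk : k ∈ Λ) :
    LinearMap.range (coordProj (H := H) (Λ \ {k})ᶜ).toLinearMap
      = LinearMap.range (coordProj (H := H) Λᶜ).toLinearMap ⊔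
        LinearMap.range (coordIncl (H := H) k).toLinearMap := by
  apply le_antisymm
  · rintro _ ⟨f, rfl⟩
    refine Submodule.mem_sup.2 ⟨_, ⟨f, rfl⟩, _, ⟨f k, rfl⟩, ?_⟩
    simp only [ContinuousLinearMap.coe_coe]
    ext i
    rw [lp.coeFn_add, Pi.add_apply, coordProj_apply, coordProj_apply]
    by_cases h : i = k
    · subst h; simp [hk]
    · by_cases hi : i ∈ Λ <;> simp [h, hi]
  · refine sup_le ?_ ?_
    · rintro _ ⟨f, rfl⟩
      refine ⟨coordProj Λᶜ f, ?_⟩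
      simp only [ContinuousLinearMap.coe_coe]
      ext i
      rw [coordProj_apply, coordProj_apply]
      by_cases h : i ∈ Λ <;> simp [h]
    · rintro _ ⟨x, rfl⟩
      refine ⟨coordIncl k x, ?_⟩
      simp only [ContinuousLinearMap.coe_coe]
      ext i
      rw [coordProj_apply]
      by_cases h : i = k <;> simp [h]

theorem zColumn_apply (n k : Fin d → ℕ) (z : Fin d → Circle) (x : H) (hk : k ∈ box n) :
    zColumn n z x k = monomial z (toInt n - toInt k) • x := by
  simp only [zColumn, sum_apply, lp.coeFn_sum]
  rw [Finset.sum_apply, Finset.sum_eq_single k]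
  · simp
  · intro l _ hl
    simp [hl.symm]
  · exact fun h => absurd hk h

theorem toeplitz_apply (A : OpTrigPoly d H) (f : Hardy d H) (i : Fin d → ℕ) :
    toeplitz A f i = ∑ k ∈ A.support, (shiftIndex k i).elim 0 fun j => A k (f j) := by
  simp only [toeplitz, sum_apply, lp.coeFn_sum]
  rw [Finset.sum_apply]
  rfl

variable {n : Fin d → ℕ} {P : OpTrigPoly d H}

/-- The box is a lower set: for `i ∈ K` and `k ≥ 0`, the index `i - k` is again in `K` whenever it
is defined. -/
theorem toeplitz_apply_eq_zero (hP : (P.support : Set (Fin d → ℤ)) ⊆ toInt '' (box n : Set _))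
    {f : Hardy d H} (hf : ∀ k ∈ box n, f k = 0) {i : Fin d → ℕ} (hi : i ∈ box n) :
    toeplitz P f i = 0 := by
  rw [toeplitz_apply]
  refine Finset.sum_eq_zero fun k hk => ?_
  obtain ⟨k, -, rfl⟩ := hP hk
  cases h : shiftIndex (toInt k) i with
  | none => rfl
  | some j =>
    rw [shiftIndex_eq_some] at h
    have hj : j ∈ box n := mem_box.2 fun t => by
      have h1 := congrFun h t
      have h2 := mem_box.1 hi t
      simp only [toInt, Pi.sub_apply] at h1
      have h3 : i t ≤ n t := h2
      change j t ≤ n t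
      omega
    simp [hf j hj]

theorem coeff_eq_zero (hP : (P.support : Set (Fin d → ℤ)) ⊆ toInt '' (box n : Set _))
    {k : Fin d → ℤ} (hk : k ∉ toInt '' (box n : Set (Fin d → ℕ))) : P k = 0 :=
  Finsupp.notMem_support_iff.1 fun h => hk (hP h)

/-- Because `n` is the top of `K`, the difference `i - n` with `i ∈ K` is nonnegative only for `i =
n`; column `n` therefore meets the rows in `K` only in the entry `P 0`. -/
theorem toeplitz_coordIncl_top (hP : (P.support : Set (Fin d → ℤ)) ⊆ toInt '' (box n : Set _))
    (x : H) :
    toeplitz P (coordIncl n x) = coordIncl n (P 0 x)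
      + coordProj (box n : Set (Fin d → ℕ))ᶜ (toeplitz P (coordIncl n x)) := by
  ext i
  rw [lp.coeFn_add, Pi.add_apply, coordProj_apply]
  by_cases hi : i ∈ box n
  · have h1 : toeplitz P (coordIncl n x) i = P (toInt i - toInt n) x := by
      rw [lp.singleContinuousLinearMap_apply, toeplitz_single]
    rw [h1]
    by_cases hin : i = n
    · subst hin; simp [hi]
    · rw [coeff_eq_zero hP]
      · simp [hin, hi]
      · rintro ⟨k, -, hk⟩
        refine hin (le_antisymm (mem_box.1 hi) fun t => ?_)
        have := congrFun hk t
        simp only [toInt, Pi.sub_apply] at this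
        change n t ≤ i t
        omega
  · have hin : i ≠ n := by
      rintro rfl
      exact hi (mem_box.2 le_rfl)
    simp [hi, hin]

theorem shiftIndex_top {k : Fin d → ℕ} (hk : k ∈ box n) :
    shiftIndex (toInt k) n = some (n - k) := by
  rw [shiftIndex_eq_some]
  funext t
  have := mem_box.1 hk t
  simp [toInt, Nat.cast_sub this]

theorem sub_mem_box (k : Fin d → ℕ) : n - k ∈ box n :=
  mem_box.2 fun _ => Nat.sub_le _ _

theorem toeplitz_apply_top (hP : (P.support : Set (Fin d → ℤ)) ⊆ toInt '' (box n : Set _))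
    (f : Hardy d H) :
    toeplitz P f n = ∑ k ∈ box n, P (toInt k) (f (n - k)) := by
  classical
  have hsub : P.support ⊆ (box n).image toInt := by
    rw [← Finset.coe_subset, Finset.coe_image]
    exact hP
  rw [toeplitz_apply, Finset.sum_subset hsub, Finset.sum_image toInt_injective.injOn]
  · refine Finset.sum_congr rfl fun k hk => ?_
    rw [shiftIndex_top hk]
    rfl
  · intro k _ hk
    rw [Finsupp.notMem_support_iff] at hk
    cases shiftIndex k n <;> simp [hk]

theorem evalTorus_apply (hP : (P.support : Set (Fin d → ℤ)) ⊆ toInt '' (box n : Set _))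
    (z : Fin d → Circle) :
    evalTorus P z = ∑ k ∈ box n, monomial z (toInt k) • P (toInt k) := by
  classical
  have hsub : P.support ⊆ (box n).image toInt := by
    rw [← Finset.coe_subset, Finset.coe_image]
    exact hP
  rw [evalTorus, Finset.sum_subset hsub, Finset.sum_image toInt_injective.injOn]
  intro k _ hk
  rw [Finsupp.notMem_support_iff.1 hk, smul_zero]

theorem toInt_sub_sub {k : Fin d → ℕ} (hk : k ∈ box n) : toInt n - toInt (n - k) = toInt k := by
  funext t
  have := mem_box.1 hk t
  simp [toInt, Nat.cast_sub this]

/-- Row `n` of `T_P` has entry `P_{n-k}` in column `k ∈ K`, matching the factor `z^{n-k}` of `Z_K`.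
-/
theorem toeplitz_zColumn_top (hP : (P.support : Set (Fin d → ℤ)) ⊆ toInt '' (box n : Set _))
    (z : Fin d → Circle) (x : H) :
    toeplitz P (zColumn n z x) n = evalTorus P z x := by
  rw [toeplitz_apply_top hP, evalTorus_apply hP, sum_apply]
  refine Finset.sum_congr rfl fun k hk => ?_
  rw [zColumn_apply _ _ _ _ (sub_mem_box k), toInt_sub_sub hk, map_smul, smul_apply]

/-- The analytic polynomial with the coefficients `L (n - k)`, `k ≤ n`, where `L` is the row of
operators `L k`, satisfies `P(z) = L Z_K(z)`. -/
def rowPoly (n : Fin d → ℕ) (L : Hardy d H →L[ℂ] H) : OpTrigPoly d H :=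
  ∑ k ∈ box n, Finsupp.single (toInt k) (L ∘L coordIncl (n - k))

theorem rowPoly_apply (L : Hardy d H →L[ℂ] H) {k : Fin d → ℕ} (hk : k ∈ box n) :
    rowPoly n L (toInt k) = L ∘L coordIncl (n - k) := by
  rw [rowPoly, Finsupp.finsetSum_apply, Finset.sum_eq_single k]
  · simp
  · intro l _ hl
    exact Finsupp.single_eq_of_ne (toInt_injective.ne hl.symm)
  · exact fun h => absurd hk h

theorem rowPoly_apply_zero (L : Hardy d H →L[ℂ] H) : rowPoly n L 0 = L ∘L coordIncl n := by
  have h0 : (0 : Fin d → ℕ) ∈ box n := mem_box.2 fun _ => Nat.zero_le _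
  have h1 := rowPoly_apply (n := n) L h0
  have h2 : toInt (0 : Fin d → ℕ) = 0 := by funext t; simp [toInt]
  have h3 : n - 0 = n := by funext t; simp
  rwa [h2, h3] at h1

theorem support_rowPoly (L : Hardy d H →L[ℂ] H) :
    ((rowPoly n L).support : Set (Fin d → ℤ)) ⊆ toInt '' (box n : Set _) := by
  classical
  intro k hk
  obtain ⟨l, hl, hkl⟩ := Finset.mem_biUnion.1 (Finsupp.support_finsetSum hk)
  exact ⟨l, hl, (Finset.mem_singleton.1 (Finsupp.support_single_subset hkl)).symm⟩

theorem evalTorus_rowPoly (L : Hardy d H →L[ℂ] H) (z : Fin d → Circle) :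
    evalTorus (rowPoly n L) z = L ∘L zColumn n z := by
  rw [evalTorus_apply (support_rowPoly L), zColumn, ContinuousLinearMap.comp_finsetSum]
  refine Finset.sum_nbij' (fun k => n - k) (fun k => n - k) (fun k _ => sub_mem_box k)
    (fun k _ => sub_mem_box k) ?_ ?_ ?_
  · intro k hk
    funext t
    exact Nat.sub_sub_self (mem_box.1 hk t)
  · intro k hk
    funext t
    exact Nat.sub_sub_self (mem_box.1 hk t)
  · intro k hk
    rw [rowPoly_apply L hk, toInt_sub_sub hk, ContinuousLinearMap.comp_smul]

theorem inner_coordIncl_left {ι : Type*} [DecidableEq ι] (k : ι) (x : H) (f : EllTwo ι H) :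
    inner ℂ (coordIncl k x) f = inner ℂ x (f k) := by
  rw [lp.singleContinuousLinearMap_apply, lp.inner_single_left]

/-- Vanishing at `n` is orthogonality to the coordinate space at `n`, so it passes to the closure of
`U`. -/
theorem apply_eq_zero_of_mem_closure {n : Fin d → ℕ} {U : Submodule ℂ (Hardy d H)}
    (hU : ∀ u ∈ U, u n = 0) {y : Hardy d H} (hy : y ∈ Uᗮᗮ) : y n = 0 := by
  rw [← inner_self_eq_zero (𝕜 := ℂ), ← inner_coordIncl_left]
  refine (Submodule.mem_orthogonal _ _).1 hy _ ((Submodule.mem_orthogonal' _ _).2 fun u hu => ?_)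
  rw [inner_coordIncl_left, hU u hu, inner_zero_right]

/-- The image of the complementary coordinates under an analytic Toeplitz operator. -/
theorem coe_map_range_coordProj_compl {n : Fin d → ℕ} {P : OpTrigPoly d H}
    (hP : (P.support : Set (Fin d → ℤ)) ⊆ toInt '' (box n : Set _)) :
    (((LinearMap.range (coordProj (H := H) (box n : Set (Fin d → ℕ))ᶜ).toLinearMap).map
        (toeplitz P).toLinearMap : Submodule ℂ (Hardy d H)) : Set (Hardy d H))
      = Set.range (coordProj (box n : Set (Fin d → ℕ))ᶜ ∘L toeplitz P ∘L
          coordProj (box n : Set (Fin d → ℕ))ᶜ) := by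
  have h : ∀ f : Hardy d H, toeplitz P (coordProj (box n : Set (Fin d → ℕ))ᶜ f)
      = coordProj (box n : Set (Fin d → ℕ))ᶜ
        (toeplitz P (coordProj (box n : Set (Fin d → ℕ))ᶜ f)) := by
    intro f
    ext i
    rw [coordProj_apply (box n : Set (Fin d → ℕ))ᶜ (toeplitz P _)]
    by_cases hi : i ∈ box n
    · rw [toeplitz_apply_eq_zero hP (fun k hk => ?_) hi]
      · simp [hi]
      · rw [coordProj_apply]
        simp [hk]
    · simp [hi]
  ext y
  constructor
  · rintro ⟨_, ⟨f, rfl⟩, rfl⟩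
    exact ⟨f, (h f).symm⟩
  · rintro ⟨f, rfl⟩
    exact ⟨_, ⟨f, rfl⟩, h f⟩

theorem apply_top_eq_zero_of_mem_map {n : Fin d → ℕ} {P : OpTrigPoly d H}
    (hP : (P.support : Set (Fin d → ℤ)) ⊆ toInt '' (box n : Set _)) :
    ∀ u ∈ (LinearMap.range (coordProj (H := H) (box n : Set (Fin d → ℕ))ᶜ).toLinearMap).map
      (toeplitz P).toLinearMap, u n = 0 := by
  intro u hu
  rw [← SetLike.mem_coe, coe_map_range_coordProj_compl hP] at hu
  obtain ⟨f, rfl⟩ := hu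
  rw [ContinuousLinearMap.comp_apply, coordProj_apply]
  simp [mem_box]

theorem coordIncl_mem_orthogonal {n : Fin d → ℕ} {U : Submodule ℂ (Hardy d H)}
    (hU : ∀ u ∈ U, u n = 0) (x : H) : coordIncl n x ∈ Uᗮ :=
  (Submodule.mem_orthogonal' _ _).2 fun u hu => by
    rw [inner_coordIncl_left, hU u hu, inner_zero_right]

end Box

/-! ### Row factorizations and the two implications -/

section Main

variable {E F G : Type*} [NormedAddCommGroup E] [InnerProductSpace ℂ E] [CompleteSpace E]
  [NormedAddCommGroup F] [InnerProductSpace ℂ F] [CompleteSpace F]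
  [NormedAddCommGroup G] [InnerProductSpace ℂ G] [CompleteSpace G]

/-- The difference is `R* P_W R` with `W` the closed range of `G₁ R J`. As `J` starts from `G`, this
`W` embeds isometrically into `G`. The density clause later becomes `ran P_k ⊆ closure (ran P_0)`.
-/
theorem exists_row_factorization (R : E →L[ℂ] F) (V : Submodule ℂ E) (J : G →L[ℂ] E) :
    ∃ L : E →L[ℂ] G,
      ContinuousLinearMap.adjoint R ∘L (V.map R.toLinearMap)ᗮ.starProjection ∘L R -
          ContinuousLinearMap.adjoint R ∘L
            ((V ⊔ LinearMap.range J.toLinearMap).map R.toLinearMap)ᗮ.starProjection ∘L R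
        = ContinuousLinearMap.adjoint L ∘L L ∧
      Set.range L ⊆ closure (Set.range (L ∘L J)) := by
  set G₁ := (V.map R.toLinearMap)ᗮ.starProjection with hG₁
  obtain ⟨U, hU⟩ := exists_adjoint_comp_self_eq_starProjection (G₁ ∘L R ∘L J)
  have hX : ((LinearMap.range J.toLinearMap).map R.toLinearMap).map G₁.toLinearMap
      = LinearMap.range (G₁ ∘L R ∘L J).toLinearMap := by
    rw [← LinearMap.range_comp, ← LinearMap.range_comp]
    rfl
  obtain ⟨hUran, hUzero⟩ := range_subset_closure_of_adjoint_comp_self U _ hU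
  refine ⟨U ∘L R, ?_, ?_⟩
  · rw [adjoint_comp_starProjection_sub, hX, ← hU, ContinuousLinearMap.adjoint_comp]
    rfl
  · rintro _ ⟨f, rfl⟩
    refine closure_mono ?_ (hUran ⟨R f, rfl⟩)
    rintro _ ⟨_, ⟨x, rfl⟩, rfl⟩
    refine ⟨x, ?_⟩
    -- What `G₁` removes from `R J x` is orthogonal to `ran G₁`, hence to `W`, so `U` does not see
    -- it.
    have h := hUzero (R (J x) - G₁ (R (J x))) ?_
    · rw [map_sub, sub_eq_zero] at h
      exact h
    · rw [Submodule.mem_orthogonal']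
      rintro _ ⟨y, rfl⟩
      exact Submodule.starProjection_inner_eq_zero _ _ (Submodule.starProjection_apply_mem _ _)

theorem exists_shortedOperator_sub_eq (M : E →L[ℂ] E) (V : Submodule ℂ E) (J : G →L[ℂ] E) :
    ∃ L : E →L[ℂ] G,
      shortedOperator M V - shortedOperator M (V ⊔ LinearMap.range J.toLinearMap)
        = ContinuousLinearMap.adjoint L ∘L L ∧
      Set.range L ⊆ closure (Set.range (L ∘L J)) := by
  have h := exists_row_factorization (CFC.sqrt M) V J
  rw [adjoint_sqrt] at h
  exact h

variable {d : ℕ} {H : Type*} [NormedAddCommGroup H] [InnerProductSpace ℂ H] [CompleteSpace H]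

theorem mem_orthogonal_orthogonal_iff {U : Submodule ℂ E} {y : E} :
    y ∈ Uᗮᗮ ↔ y ∈ closure (U : Set E) := by
  rw [← Submodule.topologicalClosure_coe, ← Submodule.orthogonal_orthogonal_eq_closure]
  rfl

/-- An outer factorization computes the difference of Schur complements. -/
theorem schurComplement_sub_of_factorization {n : Fin d → ℕ} {P : OpTrigPoly d H}
    (hP : (P.support : Set (Fin d → ℤ)) ⊆ toInt '' (box n : Set _))
    (hcol : Set.range (coordProj (box n : Set (Fin d → ℕ))ᶜ ∘L toeplitz P ∘L
          coordProj ({n} : Set (Fin d → ℕ))) ⊆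
        closure (Set.range (coordProj (box n : Set (Fin d → ℕ))ᶜ ∘L toeplitz P ∘L
          coordProj (box n : Set (Fin d → ℕ))ᶜ)))
    (hran : ∀ k ∈ box n, Set.range (P (toInt k)) ⊆ closure (Set.range (P 0)))
    (f g : Hardy d H) :
    inner ℂ ((schurComplement (ContinuousLinearMap.adjoint (toeplitz P) ∘L toeplitz P)
          (box n : Set (Fin d → ℕ)) -
        schurComplement (ContinuousLinearMap.adjoint (toeplitz P) ∘L toeplitz P)
          ((box n : Set (Fin d → ℕ)) \ {n})) f) g
      = inner ℂ (toeplitz P f n) (toeplitz P g n) := by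
  set T := toeplitz P with hT
  set V := LinearMap.range (coordProj (H := H) (box n : Set (Fin d → ℕ))ᶜ).toLinearMap with hV
  set U := V.map T.toLinearMap with hU
  have hU0 : ∀ u ∈ U, u n = 0 := apply_top_eq_zero_of_mem_map hP
  have hn : n ∈ (box n : Set (Fin d → ℕ)) := mem_box.2 le_rfl
  rw [schurComplement, schurComplement, range_coordProj_compl_diff_singleton _ hn,
    shortedOperator_adjoint_comp_self, shortedOperator_adjoint_comp_self,
    adjoint_comp_starProjection_sub, ContinuousLinearMap.comp_apply,
    ContinuousLinearMap.adjoint_inner_left, ContinuousLinearMap.comp_apply]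
  -- Column `n` splits into `P 0 x` at `n`, orthogonal to `U`, and a remainder that `hcol` puts in
  -- the closure of `U`.
  have hG : ∀ x, Uᗮ.starProjection (T (coordIncl n x)) = coordIncl n (P 0 x) := by
    intro x
    refine Submodule.eq_starProjection_of_mem_orthogonal' (coordIncl_mem_orthogonal hU0 _) ?_
      (toeplitz_coordIncl_top hP x)
    rw [mem_orthogonal_orthogonal_iff, hU, hV, coe_map_range_coordProj_compl hP]
    refine hcol ⟨coordIncl n x, ?_⟩
    rw [ContinuousLinearMap.comp_apply, ContinuousLinearMap.comp_apply, coordProj_singleton]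
    simp
    rfl
  have htop : T f n ∈ closure (Set.range (P 0)) := by
    have hmem : T f n ∈ (LinearMap.range (P 0).toLinearMap).topologicalClosure := by
      rw [hT, toeplitz_apply_top hP]
      exact Submodule.sum_mem _ fun k hk => hran k hk ⟨_, rfl⟩
    exact hmem
  -- By `hG` the space projected onto is the closure of `ran P_0` placed at coordinate `n`; by
  -- `htop` it contains the whole `n`-th entry of `T f`.
  have hproj : (((LinearMap.range (coordIncl (H := H) n).toLinearMap).map T.toLinearMap).map
      Uᗮ.starProjection.toLinearMap)ᗮᗮ.starProjection (T f) = coordIncl n (T f n) := by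
    apply Submodule.eq_starProjection_of_mem_orthogonal
    · rw [mem_orthogonal_orthogonal_iff]
      refine closure_mono ?_ (image_closure_subset_closure_image
        (coordIncl (H := H) n).continuous ⟨_, htop, rfl⟩)
      rintro _ ⟨_, ⟨x, rfl⟩, rfl⟩
      exact ⟨_, ⟨_, ⟨x, rfl⟩, rfl⟩, hG x⟩
    · apply Submodule.le_orthogonal_orthogonal
      rw [Submodule.mem_orthogonal]
      rintro _ ⟨_, ⟨_, ⟨x, rfl⟩, rfl⟩, rfl⟩
      simp only [ContinuousLinearMap.coe_coe]
      rw [hG, inner_coordIncl_left]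
      simp
  rw [hproj, inner_coordIncl_left]

/-- If the difference of Schur complements is the square of a row that takes the value `P 0` at
the last column, then the last column of the remainder lies in the closed range. -/
theorem range_subset_of_schurComplement_sub {n : Fin d → ℕ} {P : OpTrigPoly d H}
    (hP : (P.support : Set (Fin d → ℤ)) ⊆ toInt '' (box n : Set _)) (L : Hardy d H →L[ℂ] H)
    (hL : L ∘L coordIncl n = P 0)
    (hY : schurComplement (ContinuousLinearMap.adjoint (toeplitz P) ∘L toeplitz P)
          (box n : Set (Fin d → ℕ)) -
        schurComplement (ContinuousLinearMap.adjoint (toeplitz P) ∘L toeplitz P)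
          ((box n : Set (Fin d → ℕ)) \ {n}) = ContinuousLinearMap.adjoint L ∘L L) :
    Set.range (coordProj (box n : Set (Fin d → ℕ))ᶜ ∘L toeplitz P ∘L
        coordProj ({n} : Set (Fin d → ℕ))) ⊆
      closure (Set.range (coordProj (box n : Set (Fin d → ℕ))ᶜ ∘L toeplitz P ∘L
        coordProj (box n : Set (Fin d → ℕ))ᶜ)) := by
  rintro _ ⟨f, rfl⟩
  set T := toeplitz P with hT
  set V := LinearMap.range (coordProj (H := H) (box n : Set (Fin d → ℕ))ᶜ).toLinearMap with hV
  set U := V.map T.toLinearMap with hU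
  have hU0 : ∀ u ∈ U, u n = 0 := apply_top_eq_zero_of_mem_map hP
  have hn : n ∈ (box n : Set (Fin d → ℕ)) := mem_box.2 le_rfl
  have hM : 0 ≤ ContinuousLinearMap.adjoint T ∘L T :=
    (ContinuousLinearMap.nonneg_iff_isPositive _).2
      (ContinuousLinearMap.isPositive_adjoint_comp_self T)
  rw [ContinuousLinearMap.comp_apply, ContinuousLinearMap.comp_apply, coordProj_singleton,
    ← coe_map_range_coordProj_compl hP, ← mem_orthogonal_orthogonal_iff, ← hV, ← hT, ← hU,
    ← Submodule.starProjection_apply_eq_zero_iff]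
  set x := f n with hx
  set w := coordProj (box n : Set (Fin d → ℕ))ᶜ (T (coordIncl n x)) with hw
  have hdec : T (coordIncl n x) = coordIncl n (P 0 x) + w := toeplitz_coordIncl_top hP x
  have hwn : w n = 0 := by
    rw [hw, coordProj_apply]
    simp [mem_box]
  -- Both `w` and the closure of `U` vanish at `n`, so the projected remainder stays orthogonal to
  -- `coordIncl n (P 0 x)`.
  have hGw : Uᗮ.starProjection w n = 0 := by
    have h := apply_eq_zero_of_mem_closure hU0 (Submodule.sub_starProjection_mem_orthogonal w)
    rw [lp.coeFn_sub, Pi.sub_apply, hwn, zero_sub, neg_eq_zero] at h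
    exact h
  have hzero : schurComplement (ContinuousLinearMap.adjoint T ∘L T)
      ((box n : Set (Fin d → ℕ)) \ {n}) (coordIncl n x) = 0 := by
    refine (shortedOperator_isGreatest _ hM _).1.2.1 _ ?_
    rw [range_coordProj_compl_diff_singleton _ hn]
    exact Submodule.mem_sup_right ⟨x, rfl⟩
  have hself : ∀ y : H, inner ℂ y y = ((‖y‖ ^ 2 : ℝ) : ℂ) := fun y => by
    rw [inner_self_eq_norm_sq_to_K]
    norm_cast
  have hLx : L (coordIncl n x) = P 0 x := DFunLike.congr_fun hL x
  -- The `(n, n)` entry of `Y` computed twice: as `‖P 0 x‖²` through `L`, and through `T` as the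
  -- squared norm of the projected column `n`. Pythagoras then forces the projected remainder to
  -- vanish.
  have h1 := congrArg (fun A : Hardy d H →L[ℂ] Hardy d H =>
    inner ℂ (A (coordIncl n x)) (coordIncl n x)) hY
  rw [sub_apply, hzero, sub_zero, schurComplement, shortedOperator_adjoint_comp_self,
    inner_adjoint_starProjection, ContinuousLinearMap.comp_apply,
    ContinuousLinearMap.adjoint_inner_left, hself,
    hLx, hdec, map_add,
    Submodule.starProjection_eq_self_iff.2 (coordIncl_mem_orthogonal hU0 _)] at h1
  have h2 : ‖coordIncl n (P 0 x) + Uᗮ.starProjection w‖ ^ 2 = ‖P 0 x‖ ^ 2 :=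
    Complex.ofReal_injective h1
  have h3 : ‖coordIncl n (P 0 x) + Uᗮ.starProjection w‖ * ‖coordIncl n (P 0 x) +
      Uᗮ.starProjection w‖ = _ := norm_add_sq_eq_norm_sq_add_norm_sq_of_inner_eq_zero
    (𝕜 := ℂ) _ _ (by rw [inner_coordIncl_left, hGw, inner_zero_right])
  have h4 : ‖coordIncl n (P 0 x)‖ = ‖P 0 x‖ := by
    rw [lp.singleContinuousLinearMap_apply, lp.norm_single (by norm_num)]
  rw [h4] at h3
  have h5 : ‖Uᗮ.starProjection w‖ * ‖Uᗮ.starProjection w‖ = 0 := by linarith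
  exact norm_eq_zero.1 (mul_self_eq_zero.1 h5)

end Main

end OuterFactorization

end

open OuterFactorization in
theorem mainTheorem1 {H : Type*} [NormedAddCommGroup H] [InnerProductSpace ℂ H] [CompleteSpace H]
    (d : ℕ) (n : Fin d → ℕ) (Q : OpTrigPoly d H)
    (hQ : (Q.support : Set (Fin d → ℤ)) ⊆ toInt '' (box n : Set (Fin d → ℕ)) -
      toInt '' (box n : Set (Fin d → ℕ)))
    (hpos : ∀ z : Fin d → Circle, 0 ≤ evalTorus Q z) :
    (∃ P : OpTrigPoly d H,
      (P.support : Set (Fin d → ℤ)) ⊆ toInt '' (box n : Set (Fin d → ℕ)) ∧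
      (∀ z : Fin d → Circle,
        evalTorus Q z = ContinuousLinearMap.adjoint (evalTorus P z) ∘L evalTorus P z) ∧
      Set.range (coordProj (box n : Set (Fin d → ℕ))ᶜ ∘L toeplitz P ∘L
          coordProj ({n} : Set (Fin d → ℕ))) ⊆
        closure (Set.range (coordProj (box n : Set (Fin d → ℕ))ᶜ ∘L toeplitz P ∘L
          coordProj (box n : Set (Fin d → ℕ))ᶜ)) ∧
      ∀ k ∈ box n, Set.range (P (toInt k)) ⊆ closure (Set.range (P 0))) ↔
    ∀ z : Fin d → Circle,
      ContinuousLinearMap.adjoint (zColumn n z : H →L[ℂ] Hardy d H) ∘L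
        (schurComplement (toeplitz Q) (box n : Set (Fin d → ℕ)) -
          schurComplement (toeplitz Q) ((box n : Set (Fin d → ℕ)) \ {n})) ∘L
        zColumn n z = evalTorus Q z := by
  constructor
  · rintro ⟨P, hP, hPQ, hcol, hran⟩ z
    rw [toeplitz_eq_adjoint_comp_self (hP.trans (Set.image_subset_range _ _)) hPQ, hPQ]
    ext1 x
    refine ext_inner_right ℂ fun y => ?_
    rw [ContinuousLinearMap.comp_apply, ContinuousLinearMap.adjoint_inner_left,
      ContinuousLinearMap.comp_apply, schurComplement_sub_of_factorization hP hcol hran,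
      toeplitz_zColumn_top hP, toeplitz_zColumn_top hP, ContinuousLinearMap.comp_apply,
      ContinuousLinearMap.adjoint_inner_left]
  · intro h
    have hn : n ∈ (box n : Set (Fin d → ℕ)) := mem_box.2 le_rfl
    obtain ⟨L, hL, hLran⟩ := exists_shortedOperator_sub_eq (toeplitz Q)
      (LinearMap.range (coordProj (H := H) (box n : Set (Fin d → ℕ))ᶜ).toLinearMap)
      (coordIncl (H := H) n)
    have hY : schurComplement (toeplitz Q) (box n : Set (Fin d → ℕ)) -
        schurComplement (toeplitz Q) ((box n : Set (Fin d → ℕ)) \ {n})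
          = ContinuousLinearMap.adjoint L ∘L L := by
      rw [← hL, schurComplement, schurComplement, range_coordProj_compl_diff_singleton _ hn]
    have hPQ : ∀ z, evalTorus Q z = ContinuousLinearMap.adjoint (evalTorus (rowPoly n L) z) ∘L
        evalTorus (rowPoly n L) z := by
      intro z
      rw [← h z, hY, evalTorus_rowPoly, ContinuousLinearMap.adjoint_comp]
      rfl
    have hP := support_rowPoly (n := n) L
    -- The polynomial comes from a factorization of `Y` that used the square root of `T_Q`; the same
    -- `Y` is now expressed through `T_P* T_P`.
    rw [toeplitz_eq_adjoint_comp_self (hP.trans (Set.image_subset_range _ _)) hPQ] at hY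
    refine ⟨rowPoly n L, hP, hPQ,
      range_subset_of_schurComplement_sub hP L (rowPoly_apply_zero L).symm hY, fun k hk => ?_⟩
    rw [rowPoly_apply_zero, rowPoly_apply L hk]
    rintro _ ⟨x, rfl⟩
    exact hLran ⟨_, rfl⟩
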